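/- Let $n\ge 2$ and let $\Omega\subset\mathbb R^n$ be a nonempty bounded open Lipschitz domain. For a Banach space $X$ let $X^*$ be the space of bounded conjugate-linear functionals on $X$, put $H^{-1/2}(\partial\Omega)=(H^{1/2}(\partial\Omega))^*$ with pairing $\langle\cdot,\cdot\rangle_{1/2}$ (antilinear in the first, linear in the second argument), let $\gamma_D:H^1(\Omega)\to H^{1/2}(\partial\Omega)$ be the Dirichlet trace and $\gamma_D^*:H^{-1/2}(\partial\Omega)\to(H^1(\Omega))^*$ its adjoint. Let $\widetilde\Theta_1,\widetilde\Theta_2:H^{1/2}(\partial\Omega)\to H^{-1/2}(\partial\Omega)$ be compact linear operators which are symmetric, $\langle f,\widetilde\Theta_j g\rangle_{1/2}=\overline{\langle g,\widetilde\Theta_j f\rangle_{1/2}}$, and bounded from below: there is $c_j\in\mathbb R$ with $\langle f,\widetilde\Theta_j f\rangle_{1/2}\ge c_j\|f\|_{L^2(\partial\Omega)}^2$ for all $f\in H^{1/2}(\partial\Omega)$. Let $-\Delta_{\Theta_j,\Omega}$ be the operator $u\mapsto-\Delta u$ in $L^2(\Omega)$ with domain $\{u\in H^1(\Omega):\Delta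 u\in L^2(\Omega),\ (\widetilde\gamma_N+\widetilde\Theta_j\gamma_D)u=0\text{ in }H^{-1/2}(\partial\Omega)\}$, where the weak Neumann trace $\widetilde\gamma_N u\in H^{-1/2}(\partial\Omega)$ is given by $\langle\gamma_D\Phi,\widetilde\gamma_N u\rangle_{1/2}=\int_\Omega\overline{\nabla\Phi}\cdot\nabla u\,dx+\int_\Omega\overline{\Phi}\,\Delta u\,dx$ for all $\Phi\in H^1(\Omega)$. Let $-\widetilde\Delta_{\Theta_j,\Omega}:H^1(\Omega)\to(H^1(\Omega))^*$ be its extension, $$\langle u,-\widetilde\Delta_{\Theta_j,\Omega}v\rangle=\int_\Omega\overline{\nabla u}\cdot\nabla v\,dx+\langle\gamma_D u,\widetilde\Theta_j\gamma_D v\rangle_{1/2},\qquad u,v\in H^1(\Omega),$$ and let $\widetilde I_\Omega:H^1(\Omega)\to(H^1(\Omega))^*$ be the inclusion, $\langle u,\widetilde I_\Omega v\rangle=\int_\Omega\overline{u}\,v\,dx$. If $z\in\mathbb C\setminus(\sigma(-\Delta_{\Theta_1,\Omega})\cup\sigma(-\Delta_{\Theta_2,\Omega}))$, then $-\widetilde\Delta_{\Theta_j,\Omega}-z\widetilde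 I_\Omega$ is boundedly invertible for $j=1,2$, and the inverses $\widetilde R_j(z)=(-\widetilde\Delta_{\Theta_j,\Omega}-z\widetilde I_\Omega)^{-1}:(H^1(\Omega))^*\to H^1(\Omega)$ satisfy, on $(H^1(\Omega))^*$, $$\widetilde R_1(z)=\widetilde R_2(z)+\widetilde R_1(z)\,\gamma_D^*\,(\widetilde\Theta_2-\widetilde\Theta_1)\,\gamma_D\,\widetilde R_2(z).$$ -/

import Mathlib

open MeasureTheory Set
open scoped ContDiff ENNReal

noncomputable section

namespace Robin

/-- `ℝⁿ` with its Euclidean norm. -/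
abbrev Rn (n : ℕ) : Type := EuclideanSpace ℝ (Fin n)

variable {n : ℕ}

/-! ### Lipschitz domains -/

/-- `Ω` is a nonempty bounded open subset of `ℝⁿ` whose boundary has a finite open covering
`(O j)` such that, after a rigid motion `e j : ℝⁿ ≃ ℝⁿ⁻¹ × ℝ`, the set `Ω` agrees inside `O j`
with the over-graph of a (globally) Lipschitz function `φ j : ℝⁿ⁻¹ → ℝ`. -/
structure IsBoundedLipschitzDomain (Ω : Set (Rn n)) : Prop where
  isOpen : IsOpen Ω
  nonempty : Ω.Nonempty
  isBounded : Bornology.IsBounded Ω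
  lipschitz : ∃ (N : ℕ) (O : Fin N → Set (Rn n))
    (e : Fin N → (Rn n ≃ᵃⁱ[ℝ] WithLp 2 (Rn (n - 1) × ℝ))) (φ : Fin N → Rn (n - 1) → ℝ),
    (∀ j, IsOpen (O j)) ∧ frontier Ω ⊆ ⋃ j, O j ∧ (∀ j, ∃ K, LipschitzWith K (φ j)) ∧
    ∀ j, O j ∩ Ω = O j ∩ {x | φ j (e j x).fst < (e j x).snd}

/-! ### Conjugate duals -/

/-- The adjoint space `X*` of bounded conjugate-linear functionals. The pairing `⟨x, f⟩` of
`x : X` with `f : X*` is `f x`; it is antilinear in `x` and linear in `f`. -/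
abbrev ConjDual (X : Type*) [NormedAddCommGroup X] [NormedSpace ℂ X] : Type _ := X →L⋆[ℂ] ℂ

/-- The adjoint `T* : Y* → X*` of a bounded operator `T : X → Y`: `⟨x, T* g⟩ = ⟨T x, g⟩`. -/
def adj {X Y : Type*} [NormedAddCommGroup X] [NormedSpace ℂ X] [NormedAddCommGroup Y]
    [NormedSpace ℂ Y] (T : X →L[ℂ] Y) : ConjDual Y →L[ℂ] ConjDual X :=
  (ContinuousLinearMap.compSL X Y ℂ (RingHom.id ℂ) (starRingEnd ℂ)).flip T

@[simp]
theorem adj_apply {X Y : Type*} [NormedAddCommGroup X] [NormedSpace ℂ X] [NormedAddCommGroup Y]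
    [NormedSpace ℂ Y] (T : X →L[ℂ] Y) (g : ConjDual Y) (x : X) : adj T g x = g (T x) := rfl

/-- The embedding `H → H*`, `u ↦ (·, u)_H`, of a Hilbert space. -/
abbrev toDual (H : Type*) [NormedAddCommGroup H] [InnerProductSpace ℂ H] : H →L[ℂ] ConjDual H :=
  innerSLFlip ℂ

/-! ### The Sobolev space `H¹(Ω)` -/

/-- `L²(Ω)`, complex valued. -/
abbrev L2 (Ω : Set (Rn n)) : Type := Lp ℂ 2 (volume.restrict Ω)

/-- `L²(Ω)ⁿ`, complex vector fields. -/
abbrev L2Vec (Ω : Set (Rn n)) : Type := Lp (EuclideanSpace ℂ (Fin n)) 2 (volume.restrict Ω)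

/-- (Real) test functions on `Ω`, the elements of `C₀^∞(Ω)`. -/
structure IsTest (Ω : Set (Rn n)) (φ : Rn n → ℝ) : Prop where
  smooth : ContDiff ℝ ∞ φ
  compact : HasCompactSupport φ
  supp : tsupport φ ⊆ Ω

/-- The partial derivative `∂ᵢ φ`. -/
def pd (i : Fin n) (φ : Rn n → ℝ) (x : Rn n) : ℝ := fderiv ℝ φ x (EuclideanSpace.single i 1)

/-- `v` is the gradient of `u` in the sense of distributions on `Ω`. -/
def IsWeakGradient (Ω : Set (Rn n)) (u : L2 Ω) (v : L2Vec Ω) : Prop :=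
  ∀ φ : Rn n → ℝ, IsTest Ω φ → ∀ i : Fin n,
    ∫ x in Ω, pd i φ x • u x = -∫ x in Ω, φ x • v x i

/-- `f ∈ L²(Ω)` is `Δ u` in the sense of distributions on `Ω`. -/
def IsWeakLaplacian (Ω : Set (Rn n)) (u f : L2 Ω) : Prop :=
  ∀ φ : Rn n → ℝ, IsTest Ω φ →
    ∫ x in Ω, Laplacian.laplacian φ x • u x = ∫ x in Ω, φ x • f x

theorem integrable_smul_L2 {Ω : Set (Rn n)} {F : Type*} [NormedAddCommGroup F] [NormedSpace ℝ F]
    {ψ : Rn n → ℝ} (h : Continuous ψ) (hc : HasCompactSupport ψ)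
    {u : Rn n → F} (hu : MemLp u 2 (volume.restrict Ω)) :
    Integrable (fun x => ψ x • u x) (volume.restrict Ω) := by
  have h1 : MemLp ψ 2 (volume.restrict Ω) := h.memLp_of_hasCompactSupport hc
  exact memLp_one_iff_integrable.1 (hu.smul h1)

theorem memLp_coord {Ω : Set (Rn n)} (v : L2Vec Ω) (i : Fin n) :
    MemLp (fun x => v x i) 2 (volume.restrict Ω) :=
  (EuclideanSpace.proj i : EuclideanSpace ℂ (Fin n) →L[ℂ] ℂ).comp_memLp' (Lp.memLp v)

theorem IsTest.continuous_pd {Ω : Set (Rn n)} {φ : Rn n → ℝ} (h : IsTest Ω φ) (i : Fin n) :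
    Continuous (pd i φ) :=
  (h.smooth.continuous_fderiv (by simp)).clm_apply continuous_const

theorem IsTest.compact_pd {Ω : Set (Rn n)} {φ : Rn n → ℝ} (h : IsTest Ω φ) (i : Fin n) :
    HasCompactSupport (pd i φ) :=
  h.compact.fderiv_apply ℝ _

/-- The pairs `(u, ∇u)` with `u ∈ L²(Ω)` and `∇u ∈ L²(Ω)ⁿ`. -/
def H1Sub (Ω : Set (Rn n)) : Submodule ℂ (WithLp 2 (L2 Ω × L2Vec Ω)) where
  carrier := {p | IsWeakGradient Ω p.fst p.snd}
  zero_mem' := by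
    intro φ hφ i
    have h1 : ∫ x in Ω, pd i φ x • (0 : L2 Ω) x = 0 := by
      refine integral_eq_zero_of_ae ?_
      filter_upwards [Lp.coeFn_zero ℂ 2 (volume.restrict Ω)] with x hx
      rw [hx]; simp
    have h2 : ∫ x in Ω, φ x • (0 : L2Vec Ω) x i = 0 := by
      refine integral_eq_zero_of_ae ?_
      filter_upwards [Lp.coeFn_zero (EuclideanSpace ℂ (Fin n)) 2 (volume.restrict Ω)] with x hx
      rw [hx]; simp
    change ∫ x in Ω, pd i φ x • (0 : L2 Ω) x = -∫ x in Ω, φ x • (0 : L2Vec Ω) x i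
    rw [h1, h2, neg_zero]
  add_mem' := by
    intro p q hp hq φ hφ i
    have h1 : ∫ x in Ω, pd i φ x • (p.fst + q.fst) x
        = ∫ x in Ω, (pd i φ x • p.fst x + pd i φ x • q.fst x) := by
      refine integral_congr_ae ?_
      filter_upwards [Lp.coeFn_add p.fst q.fst] with x hx
      rw [hx]; simp
    have h2 : ∫ x in Ω, φ x • (p.snd + q.snd) x i
        = ∫ x in Ω, (φ x • p.snd x i + φ x • q.snd x i) := by
      refine integral_congr_ae ?_
      filter_upwards [Lp.coeFn_add p.snd q.snd] with x hx
      rw [hx]; simp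
    change ∫ x in Ω, pd i φ x • (p.fst + q.fst) x = -∫ x in Ω, φ x • (p.snd + q.snd) x i
    rw [h1, h2, integral_add, integral_add, hp φ hφ i, hq φ hφ i, neg_add]
    · exact integrable_smul_L2 hφ.smooth.continuous hφ.compact (memLp_coord _ i)
    · exact integrable_smul_L2 hφ.smooth.continuous hφ.compact (memLp_coord _ i)
    · exact integrable_smul_L2 (hφ.continuous_pd i) (hφ.compact_pd i) (Lp.memLp _)
    · exact integrable_smul_L2 (hφ.continuous_pd i) (hφ.compact_pd i) (Lp.memLp _)
  smul_mem' := by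
    intro c p hp φ hφ i
    have h1 : ∫ x in Ω, pd i φ x • (c • p.fst) x = ∫ x in Ω, c * (pd i φ x • p.fst x) := by
      refine integral_congr_ae ?_
      filter_upwards [Lp.coeFn_smul c p.fst] with x hx
      simp [hx]; ring
    have h2 : ∫ x in Ω, φ x • (c • p.snd) x i = ∫ x in Ω, c * (φ x • p.snd x i) := by
      refine integral_congr_ae ?_
      filter_upwards [Lp.coeFn_smul c p.snd] with x hx
      simp [hx]; ring
    change ∫ x in Ω, pd i φ x • (c • p.fst) x = -∫ x in Ω, φ x • (c • p.snd) x i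
    rw [h1, h2, integral_const_mul, integral_const_mul, hp φ hφ i, mul_neg]

/-- The Sobolev space `H¹(Ω)`, an inner product space with
`(u, v) = ∫_Ω ū v + ∫_Ω conj (∇u) · ∇v`. An element is stored as the pair `(u, ∇u)`. -/
abbrev H1 (Ω : Set (Rn n)) : Type := ↥(H1Sub Ω)

/-- The inclusion `H¹(Ω) → L²(Ω)`. -/
def H1.toL2 (Ω : Set (Rn n)) : H1 Ω →L[ℂ] L2 Ω :=
  (WithLp.fstL 2 ℂ (L2 Ω) (L2Vec Ω)).comp (H1Sub Ω).subtypeL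

/-- The gradient `∇ : H¹(Ω) → L²(Ω)ⁿ`. -/
def H1.grad (Ω : Set (Rn n)) : H1 Ω →L[ℂ] L2Vec Ω :=
  (WithLp.sndL 2 ℂ (L2 Ω) (L2Vec Ω)).comp (H1Sub Ω).subtypeL

/-- The inclusion `L²(Ω) → (H¹(Ω))*`, `⟨Φ, f⟩ = ∫_Ω conj Φ · f`. -/
def inclL2 (Ω : Set (Rn n)) : L2 Ω →L[ℂ] ConjDual (H1 Ω) :=
  adj (H1.toL2 Ω) ∘L toDual (L2 Ω)

/-- The inclusion `Ĩ : H¹(Ω) → (H¹(Ω))*`. -/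
def inclH1 (Ω : Set (Rn n)) : H1 Ω →L[ℂ] ConjDual (H1 Ω) := inclL2 Ω ∘L H1.toL2 Ω

/-! ### The boundary space `H^{1/2}(∂Ω)` and the Dirichlet trace -/

/-- The surface measure on `∂Ω`: the `(n-1)`-dimensional Hausdorff measure, normalised so that it
is Lebesgue measure on `(n-1)`-dimensional planes. -/
def surfaceMeasure (Ω : Set (Rn n)) : Measure (Rn n) :=
  (Measure.euclideanHausdorffMeasure (n - 1)).restrict (frontier Ω)

/-- `L²(∂Ω)`. -/
abbrev L2Bdry (Ω : Set (Rn n)) : Type := Lp ℂ 2 (surfaceMeasure Ω)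

/-- `L²(∂Ω × ∂Ω)`. -/
abbrev L2BdryProd (Ω : Set (Rn n)) : Type :=
  Lp ℂ 2 ((surfaceMeasure Ω).prod (surfaceMeasure Ω))

/-- `g(x, y) = (f(x) - f(y)) / |x - y|^{n/2}` for almost all `x, y ∈ ∂Ω`. -/
def IsGagliardoQuotient (Ω : Set (Rn n)) (f : L2Bdry Ω) (g : L2BdryProd Ω) : Prop :=
  ∀ᵐ p ∂((surfaceMeasure Ω).prod (surfaceMeasure Ω)),
    g p = (f p.1 - f p.2) / ((‖p.1 - p.2‖ ^ ((n : ℝ) / 2) : ℝ) : ℂ)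

/-- The pairs of `f ∈ L²(∂Ω)` and its square integrable quotient
`(f(x) - f(y)) / |x - y|^{n/2}`. -/
def HHalfSub (Ω : Set (Rn n)) : Submodule ℂ (WithLp 2 (L2Bdry Ω × L2BdryProd Ω)) where
  carrier := {p | IsGagliardoQuotient Ω p.fst p.snd}
  zero_mem' := by
    have h := Lp.coeFn_zero ℂ 2 (surfaceMeasure Ω)
    change IsGagliardoQuotient Ω 0 0
    unfold IsGagliardoQuotient
    filter_upwards [Measure.quasiMeasurePreserving_fst.ae h,
      Measure.quasiMeasurePreserving_snd.ae h,
      Lp.coeFn_zero ℂ 2 ((surfaceMeasure Ω).prod (surfaceMeasure Ω))] with x h1 h2 h3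
    rw [h1, h2, h3]; simp
  add_mem' := by
    intro p q hp hq
    have h := Lp.coeFn_add p.fst q.fst
    change IsGagliardoQuotient Ω (p.fst + q.fst) (p.snd + q.snd)
    change IsGagliardoQuotient Ω p.fst p.snd at hp
    change IsGagliardoQuotient Ω q.fst q.snd at hq
    unfold IsGagliardoQuotient at *
    filter_upwards [Measure.quasiMeasurePreserving_fst.ae h,
      Measure.quasiMeasurePreserving_snd.ae h,
      Lp.coeFn_add p.snd q.snd, hp, hq] with x h1 h2 h3 h4 h5
    simp only [h1, h2, h3, h4, h5, Pi.add_apply]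
    ring
  smul_mem' := by
    intro c p hp
    have h := Lp.coeFn_smul c p.fst
    change IsGagliardoQuotient Ω (c • p.fst) (c • p.snd)
    change IsGagliardoQuotient Ω p.fst p.snd at hp
    unfold IsGagliardoQuotient at *
    filter_upwards [Measure.quasiMeasurePreserving_fst.ae h,
      Measure.quasiMeasurePreserving_snd.ae h,
      Lp.coeFn_smul c p.snd, hp] with x h1 h2 h3 h4
    simp only [h1, h2, h3, h4, Pi.smul_apply, smul_eq_mul]
    ring

/-- The Sobolev(-Slobodeckij) space `H^{1/2}(∂Ω)`, with
`‖f‖² = ∫_{∂Ω} |f|² + ∫_{∂Ω} ∫_{∂Ω} |f(x) - f(y)|² / |x - y|ⁿ`. -/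
abbrev HHalf (Ω : Set (Rn n)) : Type := ↥(HHalfSub Ω)

/-- `H^{-1/2}(∂Ω) = (H^{1/2}(∂Ω))*`. -/
abbrev HNegHalf (Ω : Set (Rn n)) : Type := ConjDual (HHalf Ω)

/-- The inclusion `H^{1/2}(∂Ω) → L²(∂Ω)`. -/
def HHalf.toL2 (Ω : Set (Rn n)) : HHalf Ω →L[ℂ] L2Bdry Ω :=
  (WithLp.fstL 2 ℂ (L2Bdry Ω) (L2BdryProd Ω)).comp (HHalfSub Ω).subtypeL

/-- `T : H¹(Ω) → H^{1/2}(∂Ω)` restricts functions to the boundary: if `u ∈ H¹(Ω)` has a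
representative `w` that is continuous on the closure of `Ω`, then `T u = w|_{∂Ω}`. -/
def IsDirichletTrace (Ω : Set (Rn n)) (T : H1 Ω →L[ℂ] HHalf Ω) : Prop :=
  ∀ (u : H1 Ω) (w : Rn n → ℂ), ContinuousOn w (closure Ω) →
    (∀ᵐ x ∂(volume.restrict Ω), H1.toL2 Ω u x = w x) →
    ∀ᵐ x ∂(surfaceMeasure Ω), HHalf.toL2 Ω (T u) x = w x

open Classical in
/-- The Dirichlet trace `γ_D : H¹(Ω) → H^{1/2}(∂Ω)`: the bounded operator that extends the
restriction of continuous functions to the boundary. For bounded Lipschitz domains there is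
exactly one such operator; the value `0` is never taken for these. -/
def traceD (Ω : Set (Rn n)) : H1 Ω →L[ℂ] HHalf Ω :=
  if h : ∃ T, IsDirichletTrace Ω T then h.choose else 0

/-! ### The boundary operator -/

/-- `Θ : H^{1/2}(∂Ω) → H^{-1/2}(∂Ω)` is symmetric, bounded from below with respect to the norm of
`L²(∂Ω)`, and compact. The associated sesquilinear form is `(f, g) ↦ ⟨f, Θ g⟩ = Θ g f`. -/
structure IsRobinOperator (Ω : Set (Rn n)) (Θ : HHalf Ω →L[ℂ] HNegHalf Ω) : Prop where
  symm : ∀ f g : HHalf Ω, Θ g f = starRingEnd ℂ (Θ f g)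
  bddBelow : ∃ c : ℝ, ∀ f : HHalf Ω, c * ‖HHalf.toL2 Ω f‖ ^ 2 ≤ (Θ f f).re
  compact : IsCompactOperator Θ

/-! ### The generalized Robin Laplacian in `L²(Ω)` -/

/-- For `u ∈ H¹(Ω)` with `Δ u = f ∈ L²(Ω)`, the functional `g ∈ H^{-1/2}(∂Ω)` is the weak Neumann
trace of `u`, that is, `⟨γ_D Φ, g⟩ = ∫_Ω conj (∇Φ) · ∇u + ∫_Ω conj Φ · Δu` for `Φ ∈ H¹(Ω)`. -/
def IsWeakNeumannTrace (Ω : Set (Rn n)) (u : H1 Ω) (f : L2 Ω) (g : HNegHalf Ω) : Prop :=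
  ∀ Φ : H1 Ω, g (traceD Ω Φ)
    = inner ℂ (H1.grad Ω Φ) (H1.grad Ω u) + inner ℂ (H1.toL2 Ω Φ) f

theorem IsWeakNeumannTrace.add {Ω : Set (Rn n)} {u v : H1 Ω} {f f' : L2 Ω} {g g' : HNegHalf Ω}
    (h : IsWeakNeumannTrace Ω u f g) (h' : IsWeakNeumannTrace Ω v f' g') :
    IsWeakNeumannTrace Ω (u + v) (f + f') (g + g') := by
  intro Φ
  rw [add_apply, h Φ, h' Φ, map_add, inner_add_right, inner_add_right]
  ring

theorem IsWeakNeumannTrace.smul {Ω : Set (Rn n)} {u : H1 Ω} {f : L2 Ω} {g : HNegHalf Ω}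
    (c : ℂ) (h : IsWeakNeumannTrace Ω u f g) :
    IsWeakNeumannTrace Ω (c • u) (c • f) (c • g) := by
  intro Φ
  rw [smul_apply, h Φ, map_smul, inner_smul_right, inner_smul_right, smul_add]
  rfl

theorem IsTest.continuous_laplacian {Ω : Set (Rn n)} {φ : Rn n → ℝ} (h : IsTest Ω φ) :
    Continuous (Laplacian.laplacian φ) := by
  rw [InnerProductSpace.laplacian_eq_iteratedFDeriv_stdOrthonormalBasis]
  refine continuous_finsetSum _ fun i _ => ?_
  have := h.smooth.continuous_iteratedFDeriv (m := 2) 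
    (WithTop.coe_le_coe.2 (le_top : ((2 : ℕ) : ℕ∞) ≤ ⊤))
  fun_prop

theorem IsTest.compact_laplacian {Ω : Set (Rn n)} {φ : Rn n → ℝ} (h : IsTest Ω φ) :
    HasCompactSupport (Laplacian.laplacian φ) := by
  refine (h.compact.iteratedFDeriv (𝕜 := ℝ) 2).mono' ?_
  refine (Function.support_subset_iff'.2 fun x hx => ?_)
  rw [InnerProductSpace.laplacian_eq_iteratedFDeriv_stdOrthonormalBasis]
  have : iteratedFDeriv ℝ 2 φ x = 0 := by
    by_contra hne
    exact hx (subset_tsupport _ hne)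
  simp [this]

theorem IsWeakLaplacian.add {Ω : Set (Rn n)} {u u' f f' : L2 Ω}
    (h : IsWeakLaplacian Ω u f) (h' : IsWeakLaplacian Ω u' f') :
    IsWeakLaplacian Ω (u + u') (f + f') := by
  intro φ hφ
  have h1 : ∫ x in Ω, Laplacian.laplacian φ x • (u + u') x
      = ∫ x in Ω, (Laplacian.laplacian φ x • u x + Laplacian.laplacian φ x • u' x) := by
    refine integral_congr_ae ?_
    filter_upwards [Lp.coeFn_add u u'] with x hx
    rw [hx]; simp
  have h2 : ∫ x in Ω, φ x • (f + f') x = ∫ x in Ω, (φ x • f x + φ x • f' x) := by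
    refine integral_congr_ae ?_
    filter_upwards [Lp.coeFn_add f f'] with x hx
    rw [hx]; simp
  rw [h1, h2, integral_add, integral_add, h φ hφ, h' φ hφ]
  · exact integrable_smul_L2 hφ.smooth.continuous hφ.compact (Lp.memLp _)
  · exact integrable_smul_L2 hφ.smooth.continuous hφ.compact (Lp.memLp _)
  · exact integrable_smul_L2 hφ.continuous_laplacian hφ.compact_laplacian (Lp.memLp _)
  · exact integrable_smul_L2 hφ.continuous_laplacian hφ.compact_laplacian (Lp.memLp _)

theorem IsWeakLaplacian.smul {Ω : Set (Rn n)} {u f : L2 Ω} (c : ℂ)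
    (h : IsWeakLaplacian Ω u f) : IsWeakLaplacian Ω (c • u) (c • f) := by
  intro φ hφ
  have h1 : ∫ x in Ω, Laplacian.laplacian φ x • (c • u) x
      = ∫ x in Ω, c * (Laplacian.laplacian φ x • u x) := by
    refine integral_congr_ae ?_
    filter_upwards [Lp.coeFn_smul c u] with x hx
    simp [hx]; ring
  have h2 : ∫ x in Ω, φ x • (c • f) x = ∫ x in Ω, c * (φ x • f x) := by
    refine integral_congr_ae ?_
    filter_upwards [Lp.coeFn_smul c f] with x hx
    simp [hx]; ring
  rw [h1, h2, integral_const_mul, integral_const_mul, h φ hφ]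

/-- The graph of `-Δ_{Θ,Ω}`: the pairs `(u, -Δu)` with `u ∈ H¹(Ω)`, `Δu ∈ L²(Ω)` and
`(γ_N + Θ γ_D) u = 0` in `H^{-1/2}(∂Ω)`, where `γ_N` is the weak Neumann trace. -/
def robinGraph (Ω : Set (Rn n)) (Θ : HHalf Ω →L[ℂ] HNegHalf Ω) : Submodule ℂ (L2 Ω × L2 Ω) where
  carrier := {p | ∃ u : H1 Ω, H1.toL2 Ω u = p.1 ∧ IsWeakLaplacian Ω (H1.toL2 Ω u) (-p.2) ∧
    ∃ g : HNegHalf Ω, IsWeakNeumannTrace Ω u (-p.2) g ∧ g + Θ (traceD Ω u) = 0}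
  zero_mem' := by
    refine ⟨0, by simp, ?_, 0, ?_, by simp⟩
    · intro φ hφ
      have h := Lp.coeFn_zero ℂ 2 (volume.restrict Ω)
      rw [integral_eq_zero_of_ae, integral_eq_zero_of_ae]
      · simp only [Prod.snd_zero, neg_zero]
        filter_upwards [h] with x hx
        rw [hx]; simp
      · rw [map_zero]
        filter_upwards [h] with x hx
        rw [hx]; simp
    · intro Φ
      simp
  add_mem' := by
    rintro p q ⟨u, hu, hL, g, hg, hb⟩ ⟨v, hv, hL', g', hg', hb'⟩
    refine ⟨u + v, by simp [hu, hv], ?_, g + g', ?_, ?_⟩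
    · simpa [neg_add, add_comm] using hL.add hL'
    · simpa [neg_add, add_comm] using hg.add hg'
    · rw [map_add, map_add, add_add_add_comm, hb, hb', add_zero]
  smul_mem' := by
    rintro c p ⟨u, hu, hL, g, hg, hb⟩
    refine ⟨c • u, by simp [hu], ?_, c • g, ?_, ?_⟩
    · simpa using hL.smul c
    · simpa using hg.smul c
    · rw [map_smul, map_smul]
      ext x
      have h := congrArg (fun k : HNegHalf Ω => c * k x) hb
      simpa [mul_add] using h

/-- The distributional Laplacian is unique, so `robinGraph Ω Θ` is the graph of an operator. -/
theorem robinGraph_single {Ω : Set (Rn n)} (hΩ : IsOpen Ω) (Θ : HHalf Ω →L[ℂ] HNegHalf Ω) :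
    ∀ p ∈ robinGraph Ω Θ, p.1 = 0 → p.2 = 0 := by
  rintro p ⟨u, hu, hL, -⟩ hp
  rw [hu, hp] at hL
  suffices h : (-p.2 : L2 Ω) = 0 by simpa using h
  have h0 : ∀ᵐ x ∂(volume.restrict Ω), x ∈ Ω → (-p.2 : L2 Ω) x = 0 := by
    refine hΩ.ae_eq_zero_of_integral_contDiff_smul_eq_zero
      (((Lp.memLp (-p.2 : L2 Ω)).locallyIntegrable (by norm_num)).locallyIntegrableOn _) ?_
    intro φ h1 h2 h3
    rw [← hL φ ⟨h1, h2, h3⟩]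
    refine integral_eq_zero_of_ae ?_
    filter_upwards [Lp.coeFn_zero ℂ 2 (volume.restrict Ω)] with x hx
    rw [hx]; simp
  rw [Lp.eq_zero_iff_ae_eq_zero]
  filter_upwards [h0, ae_restrict_mem hΩ.measurableSet] with x hx hm
  exact hx hm

/-- The generalized Robin Laplacian `-Δ_{Θ,Ω}`, an unbounded operator in `L²(Ω)`. -/
def robinLaplacian (Ω : Set (Rn n)) (Θ : HHalf Ω →L[ℂ] HNegHalf Ω) : L2 Ω →ₗ.[ℂ] L2 Ω :=
  (robinGraph Ω Θ).toLinearPMap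

/-- The spectrum of an unbounded operator `A` in a Hilbert space: `z` is outside of it if and only
if `A - z` is a bijection from the domain of `A` onto the space, with bounded inverse `R`. -/
def spectrumOf {H : Type*} [NormedAddCommGroup H] [InnerProductSpace ℂ H] (A : H →ₗ.[ℂ] H) :
    Set ℂ :=
  {z | ∃ R : H →L[ℂ] H, (∀ f, ∃ h : R f ∈ A.domain, A ⟨R f, h⟩ - z • R f = f) ∧
    ∀ u : A.domain, R (A u - z • (u : H)) = u}ᶜ

/-! ### The extended operators -/

/-- The extension `-Δ̃_{Θ,Ω} : H¹(Ω) → (H¹(Ω))*` of the Robin Laplacian,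
`⟨u, -Δ̃_{Θ,Ω} v⟩ = ∫_Ω conj (∇u) · ∇v + ⟨γ_D u, Θ γ_D v⟩`. -/
def extRobinLaplacian (Ω : Set (Rn n)) (Θ : HHalf Ω →L[ℂ] HNegHalf Ω) :
    H1 Ω →L[ℂ] ConjDual (H1 Ω) :=
  adj (H1.grad Ω) ∘L toDual (L2Vec Ω) ∘L H1.grad Ω + adj (traceD Ω) ∘L Θ ∘L traceD Ω

theorem extRobinLaplacian_apply (Ω : Set (Rn n)) (Θ : HHalf Ω →L[ℂ] HNegHalf Ω) (u v : H1 Ω) :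
    extRobinLaplacian Ω Θ v u
      = inner ℂ (H1.grad Ω u) (H1.grad Ω v) + Θ (traceD Ω v) (traceD Ω u) := rfl

/-- `-Δ̃_{Θ,Ω} - z Ĩ`. -/
def extShifted (Ω : Set (Rn n)) (Θ : HHalf Ω →L[ℂ] HNegHalf Ω) (z : ℂ) :
    H1 Ω →L[ℂ] ConjDual (H1 Ω) :=
  extRobinLaplacian Ω Θ - z • inclH1 Ω

/-- The extended resolvent `(-Δ̃_{Θ,Ω} - z Ĩ)⁻¹ : (H¹(Ω))* → H¹(Ω)`, the inverse as a bounded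
operator (meaningful if `extShifted Ω Θ z` is boundedly invertible). -/
def extResolvent (Ω : Set (Rn n)) (Θ : HHalf Ω →L[ℂ] HNegHalf Ω) (z : ℂ) :
    ConjDual (H1 Ω) →L[ℂ] H1 Ω :=
  (extShifted Ω Θ z).inverse

end Robin

end

noncomputable section

namespace Robin

/-! ### Compact perturbations of the Riesz isomorphism -/

section Abstract

variable {H L : Type*} [NormedAddCommGroup H] [InnerProductSpace ℂ H] [CompleteSpace H]
  [NormedAddCommGroup L] [InnerProductSpace ℂ L] [CompleteSpace L]

/-! Write A_j = -Δ̃_{Θ_j} - zĨ. The gradient and z terms agree for j = 1, 2, so A_2 = A_1 + γ_D*(Θ_2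
- Θ_1)γ_D, and applying A_1⁻¹ on the left and A_2⁻¹ on the right gives the identity. The substance
is that A_j is invertible on all of (H¹)*, although the hypothesis on z concerns only the operator
in L².

Two facts bridge this gap. First, for some z₀ the extended operator is bijective
(`exists_extShifted_bijective`): it is the Riesz map of H¹ plus a compact operator plus a multiple
of Ĩ, and a compact form is bounded by ε‖u‖²_{H¹} + C‖u‖²_{L²} (`exists_norm_form_le`), so a large
multiple of Ĩ makes the sum coercive. Second, for f in L², A_j u = f holds exactly when u is in the
domain of the Robin Laplacian and (-Δ - z)u = f (`extShifted_eq_inclL2_iff`).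

For general F, solve at z₀ instead; the error made at z lies in L², where the L² resolvent removes
it. Injectivity is also read off from the L² resolvent, and bounded inverses come from the open
mapping theorem. -/

theorem toDual_bijective : Function.Bijective (toDual H) := by
  constructor
  · intro x y h
    refine ext_inner_left ℂ fun v => ?_
    simpa using DFunLike.congr_fun h v
  · intro F
    -- Conjugating the values of F gives a linear functional, to which Fréchet–Riesz applies.
    let G : StrongDual ℂ H :=
      ((starL ℂ : ℂ ≃L⋆[ℂ] ℂ) : ℂ →L⋆[ℂ] ℂ).comp F
    refine ⟨(InnerProductSpace.toDual ℂ H).symm G, ?_⟩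
    ext v
    rw [innerSLFlip_apply_apply, ← inner_conj_symm, InnerProductSpace.toDual_symm_apply]
    simp [G]

theorem isInvertible_of_bijective {E F : Type*} [NormedAddCommGroup E] [NormedSpace ℂ E]
    [CompleteSpace E] [NormedAddCommGroup F] [NormedSpace ℂ F] [CompleteSpace F]
    {f : E →L[ℂ] F} (h : Function.Bijective f) : f.IsInvertible :=
  ⟨ContinuousLinearEquiv.ofBijective f (LinearMap.ker_eq_bot.2 h.1)
    (LinearMap.range_eq_top.2 h.2), by ext; rfl⟩

/-- The adjoint of an injective operator has dense range; through the Riesz map of H this says that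
functionals coming from L are dense in H*. -/
theorem exists_norm_sub_adj_toDual_lt {ι : H →L[ℂ] L} (hι : Function.Injective ι)
    (F : ConjDual H) {ε : ℝ} (hε : 0 < ε) : ∃ g : L, ‖F - adj ι (toDual L g)‖ < ε := by
  obtain ⟨h, rfl⟩ := toDual_bijective.2 F
  have hd : (ContinuousLinearMap.adjoint ι).range.topologicalClosure = ⊤ := by
    rw [Submodule.topologicalClosure_eq_top_iff, ContinuousLinearMap.orthogonal_range,
      ContinuousLinearMap.adjoint_adjoint]
    exact LinearMap.ker_eq_bot.2 hι
  have hh : h ∈ closure ((ContinuousLinearMap.adjoint ι).range : Set H) := by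
    have : h ∈ (ContinuousLinearMap.adjoint ι).range.topologicalClosure := hd ▸ Submodule.mem_top
    exact this
  obtain ⟨_, ⟨g, rfl⟩, hg⟩ := Metric.mem_closure_iff.1 hh ε hε
  refine ⟨g, lt_of_le_of_lt ?_ hg⟩
  refine ContinuousLinearMap.opNorm_le_bound _ dist_nonneg fun x => ?_
  have : (toDual H h - adj ι (toDual L g)) x
      = inner ℂ x (h - ContinuousLinearMap.adjoint ι g) := by
    rw [inner_sub_right, ContinuousLinearMap.adjoint_inner_right]
    simp
  rw [this, mul_comm, dist_eq_norm]
  exact norm_inner_le_norm _ _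

/-- The form of a compact operator is infinitesimally bounded with respect to the norm of the
ambient space, up to a multiple of any weaker Hilbert norm. -/
theorem exists_norm_form_le {ι : H →L[ℂ] L} (hι : Function.Injective ι)
    {K : H →L[ℂ] ConjDual H} (hK : IsCompactOperator K) {ε : ℝ} (hε : 0 < ε) :
    ∃ C : ℝ, ∀ u : H, ‖K u u‖ ≤ ε * ‖u‖ ^ 2 + C * ‖ι u‖ ^ 2 := by
  have hδ : 0 < ε / 4 := by positivity
  -- K maps the unit ball into a totally bounded set. Take a finite ε/4-net and approximate each of
  -- its points within ε/4 by a functional from L; M bounds the norms of all these.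
  have htb := ((IsCompactOperator.isCompact_closure_image_closedBall (f := K.toLinearMap)
    hK 1).totallyBounded).subset subset_closure
  obtain ⟨t, ht, hcov⟩ := Metric.totallyBounded_iff.1 htb (ε / 4) hδ
  choose g hg using fun F : ConjDual H => exists_norm_sub_adj_toDual_lt hι F hδ
  set M : ℝ := ∑ F ∈ ht.toFinset, ‖g F‖
  have hM : 0 ≤ M := Finset.sum_nonneg fun _ _ => norm_nonneg _
  have hunit : ∀ u : H, ‖u‖ = 1 → ‖K u u‖ ≤ ε / 2 + M * ‖ι u‖ := by
    intro u hu
    obtain ⟨F, hF, hd⟩ := mem_iUnion₂.1 (hcov ⟨u, by simp [hu], rfl⟩)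
    have hd' : ‖K u - F‖ < ε / 4 := by simpa [dist_eq_norm] using hd
    have hgM : ‖g F‖ ≤ M :=
      Finset.single_le_sum (f := fun F => ‖g F‖) (fun _ _ => norm_nonneg _) (ht.mem_toFinset.2 hF)
    -- The first two terms cost ε/4 each; the third sees u only through ι u.
    have e : K u u = (K u - F) u + (F - adj ι (toDual L (g F))) u + inner ℂ (ι u) (g F) := by
      simp
    have h1 := (K u - F).le_opNorm u
    have h2 := (F - adj ι (toDual L (g F))).le_opNorm u
    have h3 := norm_inner_le_norm (𝕜 := ℂ) (ι u) (g F)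
    have h4 : ‖ι u‖ * ‖g F‖ ≤ M * ‖ι u‖ := by
      rw [mul_comm]; gcongr
    have h5 := hg F
    rw [hu, mul_one] at h1 h2
    rw [e]
    refine (norm_add₃_le).trans ?_
    linarith
  -- Scaling the unit-sphere bound gives the cross term M‖u‖‖ι u‖; Young's inequality splits it into
  -- ε/2·‖u‖² and this multiple of ‖ι u‖².
  refine ⟨M ^ 2 / (2 * ε), fun u => ?_⟩
  rcases eq_or_ne u 0 with rfl | hu
  · simp
  have hu' : 0 < ‖u‖ := norm_pos_iff.2 hu
  set a : ℂ := ((‖u‖⁻¹ : ℝ) : ℂ)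
  have ha : ‖a‖ = ‖u‖⁻¹ := by simp [a]
  have h := hunit (a • u) (by rw [norm_smul, ha, inv_mul_cancel₀ hu'.ne'])
  have e : ‖K (a • u) (a • u)‖ = ‖u‖⁻¹ ^ 2 * ‖K u u‖ := by
    have : K (a • u) (a • u) = a • starRingEnd ℂ a • K u u := by
      rw [ContinuousLinearMap.map_smul K, smul_apply, ContinuousLinearMap.map_smulₛₗ (K u)]
    rw [this, norm_smul, norm_smul, RCLike.norm_conj, ha]
    ring
  rw [e, map_smul, norm_smul, ha] at h
  have h' : ‖K u u‖ ≤ ε / 2 * ‖u‖ ^ 2 + M * ‖u‖ * ‖ι u‖ := by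
    have := mul_le_mul_of_nonneg_left h (sq_nonneg ‖u‖)
    field_simp at this ⊢
    linarith
  have h2 : M * ‖u‖ * ‖ι u‖ ≤ ε / 2 * ‖u‖ ^ 2 + M ^ 2 / (2 * ε) * ‖ι u‖ ^ 2 := by
    have : ε / 2 * ‖u‖ ^ 2 + M ^ 2 / (2 * ε) * ‖ι u‖ ^ 2 - M * ‖u‖ * ‖ι u‖
        = (ε * ‖u‖ - M * ‖ι u‖) ^ 2 / (2 * ε) := by
      field_simp
      ring
    have h0 : 0 ≤ (ε * ‖u‖ - M * ‖ι u‖) ^ 2 / (2 * ε) := by positivity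
    linarith
  linarith

/-- Lax–Milgram. With ε = 1/2 and s = C the form has real part at least ‖u‖²/2, since s‖ι u‖²
absorbs the lower-order term in the bound on K. -/
theorem exists_bijective_add_smul {ι : H →L[ℂ] L} (hι : Function.Injective ι)
    {K : H →L[ℂ] ConjDual H} (hK : IsCompactOperator K) :
    ∃ s : ℂ, Function.Bijective (toDual H + K + s • (adj ι ∘L toDual L ∘L ι)) := by
  obtain ⟨C, hC⟩ := exists_norm_form_le hι hK (ε := 1 / 2) (by norm_num)
  refine ⟨(C : ℂ), ?_⟩
  set A := toDual H + K + (C : ℂ) • (adj ι ∘L toDual L ∘L ι) with hA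
  obtain ⟨e, he⟩ := isInvertible_of_bijective (toDual_bijective (H := H))
  -- The inverse Riesz map turns A into an operator on H whose quadratic form is that of A.
  have hT : IsUnit ((e.symm : ConjDual H →L[ℂ] H) ∘L A) := by
    refine ContinuousLinearMap.isUnit_of_forall_le_norm_inner_map _ (c := 1 / 2) (by norm_num) ?_
    intro u
    have e1 : inner ℂ u (e.symm (A u)) = A u u := by
      have h := DFunLike.congr_fun (DFunLike.congr_fun he (e.symm (A u))) u
      simpa using h.symm
    have e2 : (A u u).re = ‖u‖ ^ 2 + (K u u).re + C * ‖ι u‖ ^ 2 := by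
      have : A u u = inner ℂ u u + K u u + C * inner ℂ (ι u) (ι u) := by simp [hA]
      rw [this, inner_self_eq_norm_sq_to_K, inner_self_eq_norm_sq_to_K]
      norm_cast
      rw [Complex.add_re, Complex.add_re, Complex.re_ofReal_mul]
      rfl
    have h1 : -‖K u u‖ ≤ (K u u).re := (abs_le.1 (Complex.abs_re_le_norm _)).1
    have h2 : (A u u).re ≤ ‖A u u‖ := Complex.re_le_norm _
    rw [norm_inner_symm, ContinuousLinearMap.comp_apply, ContinuousLinearEquiv.coe_coe, e1]
    have := hC u
    push_cast
    linarith
  have hb := (ContinuousLinearMap.isUnit_iff_bijective).1 hT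
  have : (A : H → ConjDual H) = e ∘ ((e.symm : ConjDual H →L[ℂ] H) ∘L A) := by
    ext1 x; simp
  rw [this]
  exact e.bijective.comp hb

end Abstract

variable {n : ℕ}

/-! ### The space `H¹(Ω)` -/

theorem memLp_ofReal {Ω : Set (Rn n)} {ψ : Rn n → ℝ} (h : Continuous ψ)
    (hc : HasCompactSupport ψ) :
    MemLp (fun x => (ψ x : ℂ)) 2 (volume.restrict Ω) :=
  (Complex.continuous_ofReal.comp h).memLp_of_hasCompactSupport
    (hc.comp_left Complex.ofReal_zero)

theorem integral_smul_eq_inner {Ω : Set (Rn n)} {ψ : Rn n → ℝ} (h : Continuous ψ)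
    (hc : HasCompactSupport ψ) (u : L2 Ω) :
    ∫ x in Ω, ψ x • u x = inner ℂ (memLp_ofReal (Ω := Ω) h hc).toLp u := by
  rw [L2.inner_def]
  refine integral_congr_ae ?_
  filter_upwards [(memLp_ofReal (Ω := Ω) h hc).coeFn_toLp] with x hx
  simp [hx, mul_comm]

theorem continuous_integral_smul {Ω : Set (Rn n)} {ψ : Rn n → ℝ} (h : Continuous ψ)
    (hc : HasCompactSupport ψ) : Continuous fun u : L2 Ω => ∫ x in Ω, ψ x • u x := by
  simp only [integral_smul_eq_inner h hc]
  fun_prop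

/-- The `i`-th component of a vector field. -/
def coordL2 (Ω : Set (Rn n)) (i : Fin n) : L2Vec Ω →L[ℂ] L2 Ω :=
  (EuclideanSpace.proj i : EuclideanSpace ℂ (Fin n) →L[ℂ] ℂ).compLpL 2 _

theorem coordL2_ae {Ω : Set (Rn n)} (i : Fin n) (v : L2Vec Ω) :
    ∀ᵐ x ∂(volume.restrict Ω), coordL2 Ω i v x = v x i :=
  ContinuousLinearMap.coeFn_compLpL _ v

theorem integral_smul_coord {Ω : Set (Rn n)} (ψ : Rn n → ℝ) (i : Fin n) (v : L2Vec Ω) :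
    ∫ x in Ω, ψ x • v x i = ∫ x in Ω, ψ x • coordL2 Ω i v x := by
  refine integral_congr_ae ?_
  filter_upwards [coordL2_ae i v] with x hx
  rw [hx]

/-- For each fixed test function both sides of the defining equation are continuous, being given by
L² inner products. Closedness makes H¹ complete, as the Riesz and open mapping arguments require. -/
theorem isClosed_H1Sub (Ω : Set (Rn n)) :
    IsClosed (H1Sub Ω : Set (WithLp 2 (L2 Ω × L2Vec Ω))) := by
  have : (H1Sub Ω : Set (WithLp 2 (L2 Ω × L2Vec Ω)))
      = ⋂ (φ : Rn n → ℝ) (_ : IsTest Ω φ) (i : Fin n),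
        {p | ∫ x in Ω, pd i φ x • p.fst x = -∫ x in Ω, φ x • p.snd x i} := by
    ext p
    simp only [mem_iInter]
    rfl
  rw [this]
  refine isClosed_iInter fun φ => isClosed_iInter fun hφ => isClosed_iInter fun i => ?_
  refine isClosed_eq ?_ ?_
  · exact (continuous_integral_smul (hφ.continuous_pd i) (hφ.compact_pd i)).comp
      (WithLp.fstL 2 ℂ (L2 Ω) (L2Vec Ω)).continuous
  · simp only [integral_smul_coord]
    exact ((continuous_integral_smul hφ.smooth.continuous hφ.compact).comp
      ((coordL2 Ω i).continuous.comp (WithLp.sndL 2 ℂ (L2 Ω) (L2Vec Ω)).continuous)).neg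

instance completeSpace_H1 (Ω : Set (Rn n)) : CompleteSpace (H1 Ω) :=
  (isClosed_H1Sub Ω).completeSpace_coe

theorem isWeakGradient_H1 {Ω : Set (Rn n)} (u : H1 Ω) :
    IsWeakGradient Ω (H1.toL2 Ω u) (H1.grad Ω u) := u.2

theorem ae_eq_zero_of_integral_test {Ω : Set (Rn n)} (hΩ : IsOpen Ω) {f : L2 Ω}
    (h : ∀ φ, IsTest Ω φ → ∫ x in Ω, φ x • f x = 0) : f = 0 := by
  have h0 : ∀ᵐ x ∂(volume.restrict Ω), x ∈ Ω → f x = 0 := by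
    refine hΩ.ae_eq_zero_of_integral_contDiff_smul_eq_zero
      (((Lp.memLp f).locallyIntegrable (by norm_num)).locallyIntegrableOn _) ?_
    intro φ h1 h2 h3
    exact h φ ⟨h1, h2, h3⟩
  rw [Lp.eq_zero_iff_ae_eq_zero]
  filter_upwards [h0, ae_restrict_mem hΩ.measurableSet] with x hx hm
  exact hx hm

/-- A function determines its weak gradient, so the stored second component carries no extra
information. -/
theorem toL2_injective {Ω : Set (Rn n)} (hΩ : IsOpen Ω) :
    Function.Injective (H1.toL2 Ω) := by
  rw [injective_iff_map_eq_zero]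
  intro u hu
  have hg : ∀ i, coordL2 Ω i (H1.grad Ω u) = 0 := by
    intro i
    refine ae_eq_zero_of_integral_test hΩ fun φ hφ => ?_
    have h := isWeakGradient_H1 u φ hφ i
    rw [hu, integral_smul_eq_inner (hφ.continuous_pd i) (hφ.compact_pd i), inner_zero_right,
      integral_smul_coord] at h
    exact neg_eq_zero.1 h.symm
  have hg0 : H1.grad Ω u = 0 := by
    rw [Lp.eq_zero_iff_ae_eq_zero]
    have h1 : ∀ᵐ x ∂(volume.restrict Ω), ∀ i, coordL2 Ω i (H1.grad Ω u) x = 0 := by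
      rw [ae_all_iff]
      intro i
      rw [hg i]
      exact Lp.coeFn_zero _ _ _
    have h2 := ae_all_iff.2 fun i => coordL2_ae i (H1.grad Ω u)
    filter_upwards [h1, h2] with x hx hx'
    ext i
    rw [← hx' i, hx i]
    rfl
  refine Subtype.ext (WithLp.ofLp_injective 2 (Prod.ext hu hg0))

/-! ### Test functions in `H¹(Ω)` -/

theorem IsTest.pd {Ω : Set (Rn n)} {φ : Rn n → ℝ} (h : IsTest Ω φ) (i : Fin n) :
    IsTest Ω (pd i φ) where
  smooth := (h.smooth.fderiv_right (m := ∞) (by simp)).clm_apply contDiff_const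
  compact := h.compact_pd i
  supp := by
    refine (closure_mono fun x hx => ?_).trans
      ((tsupport_fderiv_subset ℝ (f := φ)).trans h.supp)
    intro h0
    exact hx (by simp [Robin.pd, h0])

theorem laplacian_eq_sum_pd {φ : Rn n → ℝ} (h : ContDiff ℝ ∞ φ) (x : Rn n) :
    Laplacian.laplacian φ x = ∑ i, pd i (pd i φ) x := by
  rw [InnerProductSpace.laplacian_eq_iteratedFDeriv_orthonormalBasis φ
    (EuclideanSpace.basisFun (Fin n) ℝ)]
  refine Finset.sum_congr rfl fun i _ => ?_
  have hd : DifferentiableAt ℝ (fderiv ℝ φ) x :=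
    (h.fderiv_right (m := ∞) (by simp)).differentiable (by simp) x
  rw [iteratedFDeriv_two_apply]
  unfold pd
  rw [fderiv_clm_apply hd (differentiableAt_const _)]
  simp

/-- The gradient of a test function as a square integrable field. -/
theorem IsTest.memLp_grad {Ω : Set (Rn n)} {φ : Rn n → ℝ} (h : IsTest Ω φ) :
    MemLp (fun x => WithLp.toLp 2 fun i => (Robin.pd i φ x : ℂ)) 2 (volume.restrict Ω) := by
  refine Continuous.memLp_of_hasCompactSupport ?_ ?_
  · have := fun i => h.continuous_pd i
    fun_prop
  · refine (h.compact.fderiv ℝ).mono fun x hx h0 => hx ?_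
    ext i
    simp [Robin.pd, h0]

theorem setIntegral_of_support {Ω : Set (Rn n)} {φ : Rn n → ℝ} (h : IsTest Ω φ)
    (g : Rn n → ℝ) : ∫ x in Ω, φ x * g x = ∫ x, φ x * g x := by
  refine setIntegral_eq_integral_of_forall_compl_eq_zero fun x hx => ?_
  rw [image_eq_zero_of_notMem_tsupport fun hx' => hx (h.supp hx'), zero_mul]

theorem IsTest.integral_pd_mul {Ω : Set (Rn n)} {φ ψ : Rn n → ℝ} (hφ : IsTest Ω φ)
    (hψ : IsTest Ω ψ) (i : Fin n) :
    ∫ x in Ω, Robin.pd i ψ x * φ x = -∫ x in Ω, ψ x * Robin.pd i φ x := by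
  have hI : ∀ {f g : Rn n → ℝ}, Continuous f → HasCompactSupport f → Continuous g →
      Integrable (fun x => f x * g x) := fun hf hc hg =>
    (hf.mul hg).integrable_of_hasCompactSupport hc.mul_right
  rw [setIntegral_of_support (hψ.pd i), setIntegral_of_support hψ, eq_neg_iff_add_eq_zero,
    add_comm, ← eq_neg_iff_add_eq_zero]
  exact integral_mul_fderiv_eq_neg_fderiv_mul_of_integrable
    (hI (hψ.continuous_pd i) (hψ.compact_pd i) hφ.smooth.continuous)
    (hI hψ.smooth.continuous hψ.compact (hφ.continuous_pd i))
    (hI hψ.smooth.continuous hψ.compact hφ.smooth.continuous)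
    (fun x _ => hψ.smooth.differentiable (by simp) x)
    (fun x _ => hφ.smooth.differentiable (by simp) x)

/-- A test function as an element of `H¹(Ω)`. -/
def IsTest.toH1 {Ω : Set (Rn n)} {φ : Rn n → ℝ} (h : IsTest Ω φ) : H1 Ω :=
  ⟨WithLp.toLp 2 ((memLp_ofReal h.smooth.continuous h.compact).toLp, h.memLp_grad.toLp), by
    intro ψ hψ i
    have h1 : ∫ x in Ω, Robin.pd i ψ x
          • (memLp_ofReal (Ω := Ω) h.smooth.continuous h.compact).toLp _ x
        = ((∫ x in Ω, Robin.pd i ψ x * φ x : ℝ) : ℂ) := by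
      rw [← integral_complex_ofReal]
      refine integral_congr_ae ?_
      filter_upwards [(memLp_ofReal (Ω := Ω) h.smooth.continuous h.compact).coeFn_toLp] with x hx
      simp [hx]
    have h2 : ∫ x in Ω, ψ x • (h.memLp_grad (Ω := Ω)).toLp _ x i
        = ((∫ x in Ω, ψ x * Robin.pd i φ x : ℝ) : ℂ) := by
      rw [← integral_complex_ofReal]
      refine integral_congr_ae ?_
      filter_upwards [(h.memLp_grad (Ω := Ω)).coeFn_toLp] with x hx
      simp [hx]
    change ∫ x in Ω, Robin.pd i ψ x
          • (memLp_ofReal (Ω := Ω) h.smooth.continuous h.compact).toLp _ x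
        = -∫ x in Ω, ψ x • (h.memLp_grad (Ω := Ω)).toLp _ x i
    rw [h1, h2, h.integral_pd_mul hψ, Complex.ofReal_neg]⟩

theorem IsTest.toL2_toH1 {Ω : Set (Rn n)} {φ : Rn n → ℝ} (h : IsTest Ω φ) :
    ∀ᵐ x ∂(volume.restrict Ω), H1.toL2 Ω h.toH1 x = φ x :=
  (memLp_ofReal (Ω := Ω) h.smooth.continuous h.compact).coeFn_toLp

theorem IsTest.inner_toL2 {Ω : Set (Rn n)} {φ : Rn n → ℝ} (h : IsTest Ω φ) (u : L2 Ω) :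
    inner ℂ (H1.toL2 Ω h.toH1) u = ∫ x in Ω, φ x • u x :=
  (integral_smul_eq_inner h.smooth.continuous h.compact u).symm

/-- The partial derivatives of φ are again test functions, so they may be inserted into the
definition of the weak gradient of u. This links the form to the distributional Laplacian. -/
theorem IsTest.inner_grad {Ω : Set (Rn n)} {φ : Rn n → ℝ} (h : IsTest Ω φ) (u : H1 Ω) :
    inner ℂ (H1.grad Ω h.toH1) (H1.grad Ω u)
      = -∫ x in Ω, Laplacian.laplacian φ x • H1.toL2 Ω u x := by
  have e1 : inner ℂ (H1.grad Ω h.toH1) (H1.grad Ω u)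
      = ∫ x in Ω, ∑ i, Robin.pd i φ x • H1.grad Ω u x i := by
    rw [L2.inner_def]
    refine integral_congr_ae ?_
    filter_upwards [(h.memLp_grad (Ω := Ω)).coeFn_toLp] with x hx
    change inner ℂ ((h.memLp_grad (Ω := Ω)).toLp _ x) _ = _
    simp [hx, PiLp.inner_apply, mul_comm]
  have e2 : ∫ x in Ω, Laplacian.laplacian φ x • H1.toL2 Ω u x
      = ∫ x in Ω, ∑ i, Robin.pd i (Robin.pd i φ) x • H1.toL2 Ω u x := by
    simp only [laplacian_eq_sum_pd h.smooth, Finset.sum_smul]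
  rw [e1, e2, integral_finsetSum, integral_finsetSum, ← Finset.sum_neg_distrib]
  · refine Finset.sum_congr rfl fun i _ => ?_
    rw [isWeakGradient_H1 u _ (h.pd i) i, neg_neg]
  · intro i _
    exact integrable_smul_L2 ((h.pd i).continuous_pd i) ((h.pd i).compact_pd i) (Lp.memLp _)
  · intro i _
    exact integrable_smul_L2 (h.continuous_pd i) (h.compact_pd i) (memLp_coord _ i)

/-- The Gagliardo quotient is determined almost everywhere by f. -/
theorem HHalf.eq_zero_of_toL2 {Ω : Set (Rn n)} {f : HHalf Ω} (h : HHalf.toL2 Ω f = 0) :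
    f = 0 := by
  have h1 : ∀ᵐ x ∂(surfaceMeasure Ω), HHalf.toL2 Ω f x = 0 := by
    rw [h]; exact Lp.coeFn_zero _ _ _
  have hf : ∀ᵐ p ∂((surfaceMeasure Ω).prod (surfaceMeasure Ω)),
    f.1.snd p = (HHalf.toL2 Ω f p.1 - HHalf.toL2 Ω f p.2)
      / ((‖p.1 - p.2‖ ^ ((n : ℝ) / 2) : ℝ) : ℂ) := f.2
  refine Subtype.ext (WithLp.ofLp_injective 2 (Prod.ext h ?_))
  refine (Lp.eq_zero_iff_ae_eq_zero).2 ?_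
  filter_upwards [hf, Measure.quasiMeasurePreserving_fst.ae h1,
    Measure.quasiMeasurePreserving_snd.ae h1] with p hp hp1 hp2
  change f.1.snd p = 0
  rw [hp, hp1, hp2]
  simp

/-- Test functions have vanishing Dirichlet trace. -/
theorem IsTest.traceD_toH1 {Ω : Set (Rn n)} (hΩ : IsOpen Ω) {φ : Rn n → ℝ} (h : IsTest Ω φ) :
    traceD Ω h.toH1 = 0 := by
  unfold traceD
  split_ifs with hT
  · refine HHalf.eq_zero_of_toL2 ((Lp.eq_zero_iff_ae_eq_zero).2 ?_)
    -- φ itself is a continuous representative, and its support in the open set Ω misses the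
    -- boundary.
    have h1 := hT.choose_spec h.toH1 (fun x => (φ x : ℂ))
      (Complex.continuous_ofReal.comp h.smooth.continuous).continuousOn h.toL2_toH1
    have h2 : ∀ᵐ x ∂(surfaceMeasure Ω), x ∈ frontier Ω :=
      ae_restrict_mem isClosed_frontier.measurableSet
    filter_upwards [h1, h2] with x hx hx'
    rw [hx, image_eq_zero_of_notMem_tsupport (f := φ) fun hs => ?_]
    · rfl
    · rw [hΩ.frontier_eq] at hx'
      exact hx'.2 (h.supp hs)
  · rfl

/-! ### The extended operators -/

theorem extShifted_apply (Ω : Set (Rn n)) (Θ : HHalf Ω →L[ℂ] HNegHalf Ω) (z : ℂ) (u v : H1 Ω) :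
    extShifted Ω Θ z v u = inner ℂ (H1.grad Ω u) (H1.grad Ω v)
      + Θ (traceD Ω v) (traceD Ω u) - z * inner ℂ (H1.toL2 Ω u) (H1.toL2 Ω v) := rfl

/-- The functions in the domain of the Robin Laplacian are the weak solutions of the Robin problem
with square integrable right-hand side. -/
theorem extShifted_eq_inclL2_iff {Ω : Set (Rn n)} (hΩ : IsOpen Ω)
    (Θ : HHalf Ω →L[ℂ] HNegHalf Ω) (z : ℂ) (u : H1 Ω) (f : L2 Ω) :
    extShifted Ω Θ z u = inclL2 Ω f ↔
      (H1.toL2 Ω u, f + z • H1.toL2 Ω u) ∈ robinGraph Ω Θ := by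
  constructor
  · intro h
    have h' : ∀ Φ : H1 Ω, inner ℂ (H1.grad Ω Φ) (H1.grad Ω u) + Θ (traceD Ω u) (traceD Ω Φ)
        - z * inner ℂ (H1.toL2 Ω Φ) (H1.toL2 Ω u) = inner ℂ (H1.toL2 Ω Φ) f := fun Φ =>
      DFunLike.congr_fun h Φ
    -- The boundary condition forces this Neumann trace. Test functions Φ, whose trace vanishes,
    -- give the Laplacian; arbitrary Φ give the Neumann identity.
    refine ⟨u, rfl, ?_, -Θ (traceD Ω u), ?_, neg_add_cancel _⟩
    · intro φ hφ
      have h1 := h' hφ.toH1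
      rw [hφ.traceD_toH1 hΩ, map_zero, hφ.inner_grad] at h1
      rw [← hφ.inner_toL2, inner_neg_right, inner_add_right, inner_smul_right, ← h1]
      ring
    · intro Φ
      rw [inner_neg_right, inner_add_right, inner_smul_right, ← h' Φ, neg_apply]
      ring
  · rintro ⟨w, hw, -, g, hg, hb⟩
    -- Conversely, the Neumann identity with the boundary condition inserted is already the full
    -- weak equation.
    obtain rfl := toL2_injective hΩ hw
    ext Φ
    have h1 := hg Φ
    have h2 := DFunLike.congr_fun hb (traceD Ω Φ)
    rw [add_apply, h1] at h2
    rw [inner_neg_right, inner_add_right, inner_smul_right, zero_apply] at h2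
    rw [extShifted_apply]
    change _ = inner ℂ (H1.toL2 Ω Φ) f
    linear_combination h2

theorem exists_extShifted_bijective {Ω : Set (Rn n)} (hΩ : IsOpen Ω)
    {Θ : HHalf Ω →L[ℂ] HNegHalf Ω} (hΘ : IsCompactOperator Θ) :
    ∃ z₀ : ℂ, Function.Bijective (extShifted Ω Θ z₀) := by
  have hK : IsCompactOperator (adj (traceD Ω) ∘L Θ ∘L traceD Ω) :=
    (hΘ.comp_clm (traceD Ω)).clm_comp (adj (traceD Ω))
  obtain ⟨s, hs⟩ := exists_bijective_add_smul (toL2_injective hΩ) hK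
  -- The H¹ inner product contains the L² one, so -Δ̃ is Riesz map - Ĩ + K; matching coefficients of
  -- Ĩ gives -1 - z₀ = s.
  refine ⟨-1 - s, ?_⟩
  convert hs using 2
  ext v u
  rw [extShifted_apply]
  have e : inner ℂ u v = inner ℂ (H1.toL2 Ω u) (H1.toL2 Ω v)
      + inner ℂ (H1.grad Ω u) (H1.grad Ω v) := WithLp.prod_inner_apply u.1 v.1
  change _ = inner ℂ u v + Θ (traceD Ω v) (traceD Ω u)
    + s * inner ℂ (H1.toL2 Ω u) (H1.toL2 Ω v)
  rw [e]
  ring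

/-- Solvability on (H¹)* at one point z₀ and on L² at z together give solvability on (H¹)* at z. -/
theorem extShifted_isInvertible {Ω : Set (Rn n)} (hΩ : IsOpen Ω)
    {Θ : HHalf Ω →L[ℂ] HNegHalf Ω} (hΘ : IsCompactOperator Θ) {z : ℂ}
    (hz : z ∉ spectrumOf (robinLaplacian Ω Θ)) : (extShifted Ω Θ z).IsInvertible := by
  obtain ⟨R, hR, hR'⟩ := notMem_compl_iff.1 hz
  have hgraph : (robinLaplacian Ω Θ).graph = robinGraph Ω Θ :=
    Submodule.toLinearPMap_graph_eq _ (robinGraph_single hΩ Θ)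
  refine isInvertible_of_bijective (E := H1 Ω) (F := ConjDual (H1 Ω)) ⟨?_, ?_⟩
  · rw [injective_iff_map_eq_zero]
    intro u hu
    have h := (extShifted_eq_inclL2_iff hΩ Θ z u 0).1 (by rw [hu, map_zero])
    rw [← hgraph, LinearPMap.mem_graph_iff] at h
    obtain ⟨y, hy, hy'⟩ := h
    have h0 := hR' y
    rw [hy', hy] at h0
    simp only [zero_add, sub_self, map_zero] at h0
    exact (injective_iff_map_eq_zero _).1 (toL2_injective hΩ) u h0.symm
  · intro F
    -- If w solves the equation at z₀, then at z it yields F - (z - z₀)Ĩw. The defect is in L², so v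
    -- = R((z - z₀)w) corrects it.
    obtain ⟨z₀, -, hz₀⟩ := exists_extShifted_bijective hΩ hΘ
    obtain ⟨w, hw⟩ := hz₀ F
    obtain ⟨hd, hv⟩ := hR ((z - z₀) • H1.toL2 Ω w)
    have hmem : (R ((z - z₀) • H1.toL2 Ω w), (z - z₀) • H1.toL2 Ω w
        + z • R ((z - z₀) • H1.toL2 Ω w)) ∈ robinGraph Ω Θ := by
      rw [← hgraph, LinearPMap.mem_graph_iff]
      exact ⟨⟨_, hd⟩, rfl, sub_eq_iff_eq_add.1 hv⟩
    -- Membership in the graph lifts this value of R from L² to an element of H¹.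
    obtain ⟨v, hv, -⟩ := id hmem
    dsimp only at hv
    rw [← hv] at hmem
    refine ⟨w + v, ?_⟩
    rw [map_add, (extShifted_eq_inclL2_iff hΩ Θ z v _).2 hmem, ← hw]
    ext Φ
    change extShifted Ω Θ z w Φ + inner ℂ (H1.toL2 Ω Φ) ((z - z₀) • H1.toL2 Ω w) = _
    rw [extShifted_apply, extShifted_apply, inner_smul_right]
    ring

end Robin
end

/-! ### The resolvent identity -/

theorem lemma5p2 (n : ℕ) (hn : 2 ≤ n) (Ω : Set (Robin.Rn n))
    (hΩ : Robin.IsBoundedLipschitzDomain Ω)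
    (Θ₁ Θ₂ : Robin.HHalf Ω →L[ℂ] Robin.HNegHalf Ω)
    (h₁ : Robin.IsRobinOperator Ω Θ₁) (h₂ : Robin.IsRobinOperator Ω Θ₂)
    (z : ℂ)
    (hz : z ∉ Robin.spectrumOf (Robin.robinLaplacian Ω Θ₁) ∪
      Robin.spectrumOf (Robin.robinLaplacian Ω Θ₂)) :
    (Robin.extShifted Ω Θ₁ z).IsInvertible ∧ (Robin.extShifted Ω Θ₂ z).IsInvertible ∧
    Robin.extResolvent Ω Θ₁ z = Robin.extResolvent Ω Θ₂ z +
      Robin.extResolvent Ω Θ₁ z ∘L Robin.adj (Robin.traceD Ω) ∘L (Θ₂ - Θ₁) ∘L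
        Robin.traceD Ω ∘L Robin.extResolvent Ω Θ₂ z := by
  have i₁ := Robin.extShifted_isInvertible hΩ.isOpen h₁.compact fun h => hz (Or.inl h)
  have i₂ := Robin.extShifted_isInvertible hΩ.isOpen h₂.compact fun h => hz (Or.inr h)
  refine ⟨i₁, i₂, ?_⟩
  ext1 F
  -- With F = A_2 u, the claim becomes A_1⁻¹ A_2 u = u + A_1⁻¹ γ_D*(Θ_2 - Θ_1)γ_D u.
  obtain ⟨u, rfl⟩ := i₂.surjective F
  have e : Robin.extShifted Ω Θ₂ z u = Robin.extShifted Ω Θ₁ z u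
      + Robin.adj (Robin.traceD Ω) ((Θ₂ - Θ₁) (Robin.traceD Ω u)) := by
    ext Φ
    rw [add_apply, Robin.extShifted_apply, Robin.extShifted_apply, Robin.adj_apply]
    simp only [sub_apply]
    ring
  have e₂ : Robin.extResolvent Ω Θ₂ z (Robin.extShifted Ω Θ₂ z u) = u := i₂.inverse_apply_self u
  have e₁ : Robin.extResolvent Ω Θ₁ z (Robin.extShifted Ω Θ₁ z u) = u := i₁.inverse_apply_self u
  simp only [add_apply, ContinuousLinearMap.comp_apply]
  rw [e₂]
  conv_lhs => rw [e, map_add, e₁]
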